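/- Let $N\ge 3$, let $\mathfrak{A}_N$ be the alternating group on $N$ letters, and let $x\in\mathfrak{A}_N$. Let $\ell_{\mathbf 3}(x)$ be the least $k$ such that $x$ is a product of $k$ $3$-cycles, and let $\mathrm{Red}_{\mathbf 3}(x)$ be the set of all words $t_1t_2\cdots t_{k}$ of length $k=\ell_{\mathbf 3}(x)$ whose letters are $3$-cycles with product $x$. The braid group $$\mathfrak{B}_k=\langle\sigma_1,\dots,\sigma_{k-1}\mid \sigma_i\sigma_j=\sigma_j\sigma_i\ (|i-j|>1),\ \sigma_i\sigma_{i+1}\sigma_i=\sigma_{i+1}\sigma_i\sigma_{i+1}\ (1\le i<k-1)\rangle$$ on $k$ strands acts on $\mathrm{Red}_{\mathbf 3}(x)$ by the Hurwitz action $$\sigma_i\cdot t_1\cdots t_k=t_1\cdots t_{i-1}\,t_{i+1}\,(t_{i+1}^{-1}t_it_{i+1})\,t_{i+2}\cdots t_k .$$ Then all cycles of $x$ have odd length (fixed points being cycles of length $1$) if and only if $\mathfrak{B}_{\ell_{\mathbf 3}(x)}$ acts transitively on $\mathrm{Red}_{\mathbf 3}(x)$. -/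

import Mathlib

/-- The defining relations of the braid group on `k` strands, in the free group on
`σ₁, …, σ_{k-1}` (the generator `σ_{i+1}` is indexed by `i : Fin (k - 1)`). -/
def braidRels (k : ℕ) : Set (FreeGroup (Fin (k - 1))) :=
  {r | ∃ i j : Fin (k - 1), ((i : ℕ) + 1 < j ∨ (j : ℕ) + 1 < i) ∧
      r = (FreeGroup.of i * FreeGroup.of j) * (FreeGroup.of j * FreeGroup.of i)⁻¹} ∪
  {r | ∃ i j : Fin (k - 1), (j : ℕ) = i + 1 ∧
      r = (FreeGroup.of i * FreeGroup.of j * FreeGroup.of i) *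
        (FreeGroup.of j * FreeGroup.of i * FreeGroup.of j)⁻¹}

/-- The braid group on `k` strands, by its Artin presentation. -/
abbrev BraidGroup (k : ℕ) : Type := PresentedGroup (braidRels k)

/-- Words of length `k` in the elements of `G`. -/
abbrev GroupWord (G : Type*) (k : ℕ) : Type _ := {w : List G // w.length = k}

section Hurwitz

variable {G : Type*} [Group G]

/-- The Hurwitz operator `σ_{i+1}` (positions counted from `0`):
`t₀ ⋯ tᵢ tᵢ₊₁ ⋯ ↦ t₀ ⋯ tᵢ₊₁ (tᵢ₊₁⁻¹ tᵢ tᵢ₊₁) ⋯`. -/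
def hurwitzMove : ℕ → List G → List G
  | 0, [] => []
  | 0, [a] => [a]
  | 0, a :: b :: l => b :: (b⁻¹ * a * b) :: l
  | _ + 1, [] => []
  | i + 1, a :: l => a :: hurwitzMove i l

/-- The inverse Hurwitz operator:
`t₀ ⋯ tᵢ tᵢ₊₁ ⋯ ↦ t₀ ⋯ (tᵢ tᵢ₊₁ tᵢ⁻¹) tᵢ ⋯`. -/
def hurwitzMoveInv : ℕ → List G → List G
  | 0, [] => []
  | 0, [a] => [a]
  | 0, a :: b :: l => (a * b * a⁻¹) :: a :: l
  | _ + 1, [] => []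
  | i + 1, a :: l => a :: hurwitzMoveInv i l

theorem hurwitzMove_length (i : ℕ) (l : List G) : (hurwitzMove i l).length = l.length := by
  fun_induction hurwitzMove i l <;> simp_all

theorem hurwitzMoveInv_length (i : ℕ) (l : List G) :
    (hurwitzMoveInv i l).length = l.length := by
  fun_induction hurwitzMoveInv i l <;> simp_all

theorem hurwitzMoveInv_move (i : ℕ) (l : List G) : hurwitzMoveInv i (hurwitzMove i l) = l := by
  fun_induction hurwitzMove i l <;> simp_all [hurwitzMoveInv, mul_assoc]

theorem hurwitzMove_moveInv (i : ℕ) (l : List G) : hurwitzMove i (hurwitzMoveInv i l) = l := by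
  fun_induction hurwitzMoveInv i l <;> simp_all [hurwitzMove, mul_assoc]

theorem hurwitzMove_prod (i : ℕ) (l : List G) : (hurwitzMove i l).prod = l.prod := by
  fun_induction hurwitzMove i l <;> simp_all [mul_assoc]

theorem hurwitzMove_mem {T : Set G} (hT : ∀ g : G, ∀ t ∈ T, g * t * g⁻¹ ∈ T) (i : ℕ) (l : List G)
    (hl : ∀ t ∈ l, t ∈ T) : ∀ t ∈ hurwitzMove i l, t ∈ T := by
  fun_induction hurwitzMove i l with
  | case3 a b l =>
    have h := hT b⁻¹ a (hl a (by simp))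
    simp_all
  | _ => simp_all

theorem hurwitzMoveInv_mem {T : Set G} (hT : ∀ g : G, ∀ t ∈ T, g * t * g⁻¹ ∈ T) (i : ℕ)
    (l : List G) (hl : ∀ t ∈ l, t ∈ T) : ∀ t ∈ hurwitzMoveInv i l, t ∈ T := by
  fun_induction hurwitzMoveInv i l with
  | case3 a b l =>
    have h := hT a b (hl b (by simp))
    simp_all
  | _ => simp_all

theorem hurwitzMove_comm (i j : ℕ) (h : i + 1 < j) (l : List G) :
    hurwitzMove i (hurwitzMove j l) = hurwitzMove j (hurwitzMove i l) := by
  induction i generalizing j l with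
  | zero =>
    obtain ⟨j, rfl⟩ : ∃ m, j = m + 2 := ⟨j - 2, by omega⟩
    match l with
    | [] => simp [hurwitzMove]
    | [a] => simp [hurwitzMove]
    | a :: b :: l => simp [hurwitzMove]
  | succ i ih =>
    obtain ⟨j, rfl⟩ : ∃ m, j = m + 1 := ⟨j - 1, by omega⟩
    match l with
    | [] => simp [hurwitzMove]
    | a :: l => simp [hurwitzMove, ih j (by omega) l]

theorem hurwitzMove_braid (i : ℕ) (l : List G) (h : i + 2 < l.length) :
    hurwitzMove i (hurwitzMove (i + 1) (hurwitzMove i l)) =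
      hurwitzMove (i + 1) (hurwitzMove i (hurwitzMove (i + 1) l)) := by
  induction i generalizing l with
  | zero =>
    match l with
    | [] => simp at h
    | [a] => simp at h
    | [a, b] => simp at h
    | a :: b :: c :: l => simp [hurwitzMove, mul_assoc]
  | succ i ih =>
    match l with
    | [] => simp at h
    | a :: l =>
      have := ih l (by simp at h; omega)
      simpa [hurwitzMove] using this

/-- The Hurwitz operator as a permutation of the words of length `k`. -/
def hurwitzPerm (G : Type*) [Group G] (k : ℕ) (i : Fin (k - 1)) :
    Equiv.Perm (GroupWord G k) where
  toFun w := ⟨hurwitzMove i w.1, (hurwitzMove_length _ _).trans w.2⟩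
  invFun w := ⟨hurwitzMoveInv i w.1, (hurwitzMoveInv_length _ _).trans w.2⟩
  left_inv _ := Subtype.ext (hurwitzMoveInv_move _ _)
  right_inv _ := Subtype.ext (hurwitzMove_moveInv _ _)

theorem hurwitzPerm_rels (G : Type*) [Group G] (k : ℕ) :
    ∀ r ∈ braidRels k, FreeGroup.lift (hurwitzPerm G k) r = 1 := by
  rintro r (⟨i, j, hij, rfl⟩ | ⟨i, j, hij, rfl⟩)
  · rw [map_mul, map_inv, mul_inv_eq_one]
    ext1 w
    apply Subtype.ext
    simp only [map_mul, FreeGroup.lift_apply_of, Equiv.Perm.mul_apply]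
    rcases hij with h | h
    · exact hurwitzMove_comm _ _ h _
    · exact (hurwitzMove_comm _ _ h _).symm
  · rw [map_mul, map_inv, mul_inv_eq_one]
    ext1 w
    apply Subtype.ext
    simp only [map_mul, FreeGroup.lift_apply_of, Equiv.Perm.mul_apply]
    have hj := j.2
    have hw := w.2
    have := hurwitzMove_braid (i : ℕ) w.1 (by omega)
    simpa [hurwitzPerm, hij] using this

/-- The homomorphism from the braid group on `k` strands to the permutations of the words of
length `k` that sends each generator to its Hurwitz operator. -/
def hurwitzHom (G : Type*) [Group G] (k : ℕ) : BraidGroup k →* Equiv.Perm (GroupWord G k) :=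
  PresentedGroup.toGroup (hurwitzPerm_rels G k)

/-- The Hurwitz action of the braid group on `k` strands on the words of length `k`. -/
instance hurwitzAction (G : Type*) [Group G] (k : ℕ) :
    MulAction (BraidGroup k) (GroupWord G k) :=
  MulAction.compHom _ (hurwitzHom G k)

theorem hurwitz_of_smul (k : ℕ) (i : Fin (k - 1)) (w : GroupWord G k) :
    ((PresentedGroup.of i : BraidGroup k) • w).1 = hurwitzMove i w.1 := by
  change (hurwitzHom G k (PresentedGroup.of i) w).1 = _
  rw [hurwitzHom, PresentedGroup.toGroup.of]
  rfl

/-- The length of `g` with respect to `T`: the least `k` such that `g` is a product of `k`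
elements of `T`. -/
noncomputable def wordLength (T : Set G) (g : G) : ℕ :=
  sInf {k : ℕ | ∃ w : List G, w.length = k ∧ (∀ t ∈ w, t ∈ T) ∧ w.prod = g}

/-- The set of all `T`-reduced factorizations of `g`. -/
def reducedWords (T : Set G) (g : G) : Set (GroupWord G (wordLength T g)) :=
  {w | (∀ t ∈ w.1, t ∈ T) ∧ w.1.prod = g}

theorem hurwitz_smul_mem_reducedWords {T : Set G} (hT : ∀ g : G, ∀ t ∈ T, g * t * g⁻¹ ∈ T) (g : G)
    (b : BraidGroup (wordLength T g)) {w : GroupWord G (wordLength T g)}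
    (hw : w ∈ reducedWords T g) : b • w ∈ reducedWords T g := by
  induction b using PresentedGroup.induction_on with
  | H z =>
  induction z using FreeGroup.induction_on generalizing w with
  | C1 => simpa using hw
  | of i =>
    change (PresentedGroup.of i : BraidGroup (wordLength T g)) • w ∈ _
    refine ⟨?_, ?_⟩ <;> rw [hurwitz_of_smul]
    · exact hurwitzMove_mem hT _ _ hw.1
    · exact (hurwitzMove_prod _ _).trans hw.2
  | inv_of i _ =>
    have key : ((PresentedGroup.of i : BraidGroup (wordLength T g))⁻¹ • w).1 =
        hurwitzMoveInv i w.1 := by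
      have h := hurwitz_of_smul (wordLength T g) i
        ((PresentedGroup.of i : BraidGroup (wordLength T g))⁻¹ • w)
      rw [smul_inv_smul] at h
      rw [h, hurwitzMoveInv_move]
    change (PresentedGroup.of i : BraidGroup (wordLength T g))⁻¹ • w ∈ _
    refine ⟨?_, ?_⟩ <;> rw [key]
    · exact hurwitzMoveInv_mem hT _ _ hw.1
    · rw [← hurwitzMove_prod (i : ℕ), hurwitzMove_moveInv]
      exact hw.2
  | mul x y hx hy =>
    rw [map_mul, mul_smul]
    exact hx (hy hw)

/-- The set of `T`-reduced factorizations of `g`, as a set with the Hurwitz action, for `T` closed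
under conjugation. -/
def reducedFactorizations (T : Set G) (hT : ∀ g : G, ∀ t ∈ T, g * t * g⁻¹ ∈ T) (g : G) :
    SubMulAction (BraidGroup (wordLength T g)) (GroupWord G (wordLength T g)) where
  carrier := reducedWords T g
  smul_mem' b _ hw := hurwitz_smul_mem_reducedWords hT g b hw

end Hurwitz

/-- The set of `3`-cycles in the alternating group on `N` letters. -/
def threeCycles (N : ℕ) : Set (alternatingGroup (Fin N)) :=
  {t | (t : Equiv.Perm (Fin N)).IsThreeCycle}

theorem threeCycles_conj (N : ℕ) :
    ∀ g : alternatingGroup (Fin N), ∀ t ∈ threeCycles N, g * t * g⁻¹ ∈ threeCycles N := by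
  intro g t ht
  simpa [threeCycles, Equiv.Perm.IsThreeCycle, Equiv.Perm.cycleType_conj] using ht

/-- The elements of the alternating group all of whose cycles have odd length (fixed points, which
`cycleType` leaves out, are cycles of length `1`). -/
def oddCyclePerms (N : ℕ) : Set (alternatingGroup (Fin N)) :=
  {x | ∀ n ∈ (x : Equiv.Perm (Fin N)).cycleType, Odd n}

/-! Odd cycles imply transitivity. Left multiplication by a `3`-cycle lowers the number of cycles by
at most two (`numCycles_le_three_cycle_mul`), so a word with product `x` has length at least half of
`N` minus the number of cycles of `x`. When all cycles of `x` are odd, peeling off `3`-cycles `y ↦ x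
y ↦ x (x y) ↦ y` attains this bound, so the reduced words are exactly the extremal ones:
`IsSeparatedWord`. Induction on length then connects them (`hurwitzConnected`). Every such word can
be moved to one starting with a `consecutiveCycle`, words with equal first letter are connected by
induction, and the base point can be moved: by two steps along its cycle, hence to every point of
this odd cycle, and freely to any other nontrivial cycle (`HurwitzConnected.linked`).

An even cycle obstructs transitivity. In a Clifford algebra the `3`-cycle `(a b c)` lifts to `(e a -
e b) * (e b - e c)`. These lifts are equivariant under conjugation by one another, so the product
`P` of the lifts of a word is a Hurwitz invariant. An even cycle `c` of `x` is an odd permutation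
commuting with `x`, so conjugation by `c` preserves the reduced words of `x`; but it replaces `P` by
`-P` (`IsCliffordFamily.spinProd_conj`). Since `P` is invertible and `2` is too, the two words lie
in different orbits. -/

open Equiv Equiv.Perm

/-! ### Clifford lifts of `3`-cycles and the sign invariant. -/

section SpinLift

variable {α : Type*} {R : Type*} [Ring R]

/-- A family of pairwise anticommuting elements of square `1`. -/
structure IsCliffordFamily (e : α → R) : Prop where
  sq : ∀ i, e i * e i = 1
  anticomm : ∀ i j, i ≠ j → e i * e j = -(e j * e i)

/-- The lift of a `3`-cycle `t` to the ring generated by a Clifford family, up to scaling. -/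
def spinLift [Fintype α] (e : α → R) (t : Perm α) : R := ∑ i, (e i * e (t i) - 1) + 2

/-- The product of the lifts of the letters of a word. -/
def spinProd [Fintype α] (e : α → R) (w : List (Perm α)) : R := (w.map (spinLift e)).prod

/-- The product of the vectors `e a - e b` attached to a list of transpositions `(a b)`. -/
def pinProd (e : α → R) (l : List (α × α)) : R := (l.map fun p => e p.1 - e p.2).prod

namespace IsCliffordFamily

variable {e : α → R}

/-- Conjugation by a root is minus the reflection in it, and this reflection swaps two basis
vectors. -/
theorem root_mul [DecidableEq α] (he : IsCliffordFamily e) (a b i : α) (hab : a ≠ b) :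
    (e a - e b) * e i = -(e (swap a b i) * (e a - e b)) := by
  by_cases hia : i = a
  · subst hia
    simp only [swap_apply_left, sub_mul, mul_sub, he.sq]
    abel
  by_cases hib : i = b
  · subst hib
    simp only [swap_apply_right, sub_mul, mul_sub, he.sq]
    abel
  rw [swap_apply_of_ne_of_ne hia hib, sub_mul, mul_sub, he.anticomm a i (Ne.symm hia),
    he.anticomm b i (Ne.symm hib)]
  abel

theorem root_sq (he : IsCliffordFamily e) (a b : α) (hab : a ≠ b) :
    (e a - e b) * (e a - e b) = 2 := by
  simp only [sub_mul, mul_sub, he.sq]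
  rw [he.anticomm a b hab, ← one_add_one_eq_two]
  abel

/-- The sum defining `spinLift` needs no choice of starting point, which makes it visibly
equivariant. Fixed points contribute `0`; the three moved points contribute `-3`, which the added
`2` turns into the constant term `-1` of the product of roots. -/
theorem spinLift_swap_mul_swap [Fintype α] [DecidableEq α] (he : IsCliffordFamily e) (a b c : α)
    (hab : a ≠ b) (hac : a ≠ c) (hbc : b ≠ c) :
    spinLift e (swap a b * swap b c) = (e a - e b) * (e b - e c) := by
  have hsum : ∑ i, (e i * e ((swap a b * swap b c) i) - 1) =
      ∑ i ∈ {a, b, c}, (e i * e ((swap a b * swap b c) i) - 1) := by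
    symm
    apply Finset.sum_subset (Finset.subset_univ _)
    intro i _ hi
    simp only [Finset.mem_insert, Finset.mem_singleton, not_or] at hi
    rw [Perm.mul_apply, swap_apply_of_ne_of_ne hi.2.1 hi.2.2, swap_apply_of_ne_of_ne hi.1 hi.2.1,
      he.sq, sub_self]
  rw [spinLift, hsum, Finset.sum_insert (by simp [hab, hac]), Finset.sum_insert (by simp [hbc]),
    Finset.sum_singleton]
  have h1 : (swap a b * swap b c) a = b := by
    rw [Perm.mul_apply, swap_apply_of_ne_of_ne hab hac, swap_apply_left]
  have h2 : (swap a b * swap b c) b = c := by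
    rw [Perm.mul_apply, swap_apply_left, swap_apply_of_ne_of_ne hac.symm hbc.symm]
  have h3 : (swap a b * swap b c) c = a := by
    rw [Perm.mul_apply, swap_apply_right, swap_apply_right]
  rw [h1, h2, h3, sub_mul, mul_sub, mul_sub, he.sq, he.anticomm c a hac.symm,
    ← one_add_one_eq_two]
  abel

theorem pinProd_mul [DecidableEq α] (he : IsCliffordFamily e) (l : List (α × α))
    (hl : ∀ p ∈ l, p.1 ≠ p.2) (i : α) :
    pinProd e l * e i =
      (-1) ^ l.length * (e ((l.map fun p => swap p.1 p.2).prod i) * pinProd e l) := by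
  induction l with
  | nil => simp [pinProd]
  | cons p l ih =>
    have h1 := ih fun q hq => hl q (by simp [hq])
    have h2 := he.root_mul p.1 p.2 ((l.map fun p => swap p.1 p.2).prod i) (hl p (by simp))
    have hc : (e p.1 - e p.2) * (-1) ^ l.length = (-1) ^ l.length * (e p.1 - e p.2) :=
      ((Commute.neg_one_left _).pow_left _).symm
    have hp : pinProd e (p :: l) = (e p.1 - e p.2) * pinProd e l := by simp [pinProd]
    rw [hp, mul_assoc, h1, ← mul_assoc, hc, mul_assoc, ← mul_assoc (e p.1 - e p.2), h2,
      List.length_cons, pow_succ, List.map_cons, List.prod_cons, Perm.mul_apply]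
    simp only [mul_assoc, neg_mul, one_mul, mul_neg]

theorem isUnit_root [Algebra ℚ R] (he : IsCliffordFamily e) (a b : α) (hab : a ≠ b) :
    IsUnit (e a - e b) := by
  have h2 : IsUnit (2 : R) := by
    have : (2 : R) = algebraMap ℚ R 2 := (map_ofNat (algebraMap ℚ R) 2).symm
    rw [this]
    exact (isUnit_iff_ne_zero.2 two_ne_zero).map _
  have hs := he.root_sq a b hab
  exact ((Commute.refl (e a - e b)).isUnit_mul_iff.1 (hs ▸ h2)).1

theorem isUnit_pinProd [Algebra ℚ R] (he : IsCliffordFamily e) (l : List (α × α))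
    (hl : ∀ p ∈ l, p.1 ≠ p.2) :
    IsUnit (pinProd e l) := by
  induction l with
  | nil => simp [pinProd]
  | cons p l ih =>
    have hp : pinProd e (p :: l) = (e p.1 - e p.2) * pinProd e l := by simp [pinProd]
    rw [hp]
    exact (he.isUnit_root _ _ (hl p (by simp))).mul (ih fun q hq => hl q (by simp [hq]))

section Fintype

variable [Fintype α] [DecidableEq α]

theorem exists_roots_of_isThreeCycle (he : IsCliffordFamily e) {t : Perm α} (ht : t.IsThreeCycle) :
    ∃ l : List (α × α), l.length = 2 ∧ (∀ p ∈ l, p.1 ≠ p.2) ∧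
      (l.map fun p => swap p.1 p.2).prod = t ∧ pinProd e l = spinLift e t := by
  obtain ⟨a, ha⟩ : t.support.Nonempty := by
    rw [← Finset.card_pos, ht.card_support]
    norm_num
  have h1 := ht.eq_swap_mul_swap_iff_mem_support.2 ha
  have h2 := ht.nodup_iff_mem_support.2 ha
  simp only [List.nodup_cons, List.mem_cons, List.not_mem_nil, or_false, not_or] at h2
  refine ⟨[(a, t a), (t a, t (t a))], rfl, ?_, ?_, ?_⟩
  · simp [h2.1.1, h2.2.1]
  · simpa using h1.symm
  · have h3 := he.spinLift_swap_mul_swap a (t a) (t (t a)) h2.1.1 h2.1.2 h2.2.1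
    rw [← h1] at h3
    simp [pinProd, h3]

theorem spinLift_mul (he : IsCliffordFamily e) {t : Perm α} (ht : t.IsThreeCycle) (i : α) :
    spinLift e t * e i = e (t i) * spinLift e t := by
  obtain ⟨l, hl2, hl, hprod, hpin⟩ := he.exists_roots_of_isThreeCycle ht
  have h := he.pinProd_mul l hl i
  rwa [hl2, hprod, hpin, neg_one_sq, one_mul] at h

theorem isUnit_spinLift [Algebra ℚ R] (he : IsCliffordFamily e) {t : Perm α}
    (ht : t.IsThreeCycle) : IsUnit (spinLift e t) := by
  obtain ⟨l, _, hl, _, hpin⟩ := he.exists_roots_of_isThreeCycle ht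
  exact hpin ▸ he.isUnit_pinProd l hl

theorem spinProd_mul (he : IsCliffordFamily e) (w : List (Perm α))
    (hw : ∀ t ∈ w, t.IsThreeCycle) (i : α) :
    spinProd e w * e i = e (w.prod i) * spinProd e w := by
  induction w with
  | nil => simp [spinProd]
  | cons t w ih =>
    have h1 := ih fun s hs => hw s (by simp [hs])
    have hp : spinProd e (t :: w) = spinLift e t * spinProd e w := by simp [spinProd]
    rw [hp, mul_assoc, h1, ← mul_assoc, he.spinLift_mul (hw t (by simp)), mul_assoc,
      List.prod_cons, Perm.mul_apply]

theorem isUnit_spinProd [Algebra ℚ R] (he : IsCliffordFamily e) (w : List (Perm α))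
    (hw : ∀ t ∈ w, t.IsThreeCycle) : IsUnit (spinProd e w) := by
  induction w with
  | nil => simp [spinProd]
  | cons t w ih =>
    have hp : spinProd e (t :: w) = spinLift e t * spinProd e w := by simp [spinProd]
    rw [hp]
    exact (he.isUnit_spinLift (hw t (by simp))).mul (ih fun s hs => hw s (by simp [hs]))

end Fintype

end IsCliffordFamily

section Conj

variable {e : α → R}

/-- `spinLift` has only terms of degree `0` and `2` in the `e i`, so the sign `(-1) ^ m` occurs
twice and cancels. -/
theorem mul_spinLift_of_conj [Fintype α] {C : R} {c : Perm α} {m : ℕ}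
    (hC : ∀ i, C * e i = (-1) ^ m * (e (c i) * C)) (t : Perm α) :
    C * spinLift e t = spinLift e (c * t * c⁻¹) * C := by
  have hpair : ∀ i j, C * (e i * e j) = e (c i) * e (c j) * C := by
    intro i j
    have hcomm : ∀ r : R, r * (-1) ^ m = (-1) ^ m * r := fun r =>
      ((Commute.neg_one_left r).pow_left m).symm
    have hsq : ((-1 : R)) ^ m * (-1) ^ m = 1 := by
      rw [← pow_add, ← two_mul, pow_mul, neg_one_sq, one_pow]
    calc C * (e i * e j) = (-1) ^ m * (e (c i) * (C * e j)) := by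
          rw [← mul_assoc, hC]; simp only [mul_assoc]
      _ = (-1) ^ m * ((e (c i) * (-1) ^ m) * (e (c j) * C)) := by
          rw [hC]; simp only [mul_assoc]
      _ = ((-1) ^ m * (-1) ^ m) * (e (c i) * (e (c j) * C)) := by
          rw [hcomm]; simp only [mul_assoc]
      _ = _ := by rw [hsq, one_mul, mul_assoc]
  have hsum : ∑ i, (e i * e ((c * t * c⁻¹) i) - 1) = ∑ i, (e (c i) * e (c (t i)) - 1) := by
    rw [← Equiv.sum_comp c]
    simp
  rw [spinLift, spinLift, hsum, mul_add, add_mul, Finset.mul_sum, Finset.sum_mul,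
    (Commute.ofNat_left 2 C).eq]
  congr 1
  refine Finset.sum_congr rfl fun i _ => ?_
  rw [mul_sub, sub_mul, hpair, mul_one, one_mul]

theorem mul_spinProd_of_conj [Fintype α] {C : R} {c : Perm α} {m : ℕ}
    (hC : ∀ i, C * e i = (-1) ^ m * (e (c i) * C)) (w : List (Perm α)) :
    C * spinProd e w = spinProd e (w.map fun t => c * t * c⁻¹) * C := by
  induction w with
  | nil => simp [spinProd]
  | cons t w ih =>
    have hp : ∀ (s : Perm α) v, spinProd e (s :: v) = spinLift e s * spinProd e v := by
      simp [spinProd]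
    rw [List.map_cons, hp, hp, ← mul_assoc, mul_spinLift_of_conj hC, mul_assoc, ih,
      ← mul_assoc]

theorem mul_pinProd_of_comm {P : R} {x : Perm α} (hP : ∀ i, P * e i = e (x i) * P)
    (l : List (α × α)) : P * pinProd e l = pinProd e (l.map (Prod.map x x)) * P := by
  induction l with
  | nil => simp [pinProd]
  | cons p l ih =>
    have hp : ∀ (q : α × α) m, pinProd e (q :: m) = (e q.1 - e q.2) * pinProd e m := by
      simp [pinProd]
    rw [List.map_cons, hp, hp, ← mul_assoc, mul_sub, hP, hP, ← sub_mul, mul_assoc, ih, mul_assoc]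
    rfl

theorem mul_pinProd_of_anticomm {P : R} {x : Perm α} (hP : ∀ i, P * e i = -(e (x i) * P))
    (l : List (α × α)) :
    P * pinProd e l = (-1) ^ l.length * (pinProd e (l.map (Prod.map x x)) * P) := by
  induction l with
  | nil => simp [pinProd]
  | cons p l ih =>
    have hp : ∀ (q : α × α) m, pinProd e (q :: m) = (e q.1 - e q.2) * pinProd e m := by
      simp [pinProd]
    have hc : ∀ r : R, r * (-1) ^ l.length = (-1) ^ l.length * r := fun r =>
      ((Commute.neg_one_left r).pow_left _).symm
    rw [List.map_cons, hp, hp, ← mul_assoc, mul_sub, hP, hP, sub_neg_eq_add, neg_add_eq_sub,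
      ← neg_sub, ← sub_mul, neg_mul, mul_assoc, ih, ← mul_assoc, hc, List.length_cons, pow_succ]
    simp [mul_assoc]

end Conj

variable [Fintype α] [DecidableEq α] {e : α → R}

theorem IsCliffordFamily.spinProd_hurwitzMove (he : IsCliffordFamily e) (i : ℕ)
    (l : List (Perm α)) (hl : ∀ t ∈ l, t.IsThreeCycle) :
    spinProd e (hurwitzMove i l) = spinProd e l := by
  fun_induction hurwitzMove i l with
  | case3 a b l =>
    have hb : ∀ i, spinLift e b * e i = (-1) ^ 0 * (e (b i) * spinLift e b) := by
      simpa using he.spinLift_mul (hl b (by simp))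
    have h := mul_spinLift_of_conj hb (b⁻¹ * a * b)
    have hab : b * (b⁻¹ * a * b) * b⁻¹ = a := by group
    rw [hab] at h
    simp only [spinProd, List.map_cons, List.prod_cons, ← mul_assoc, h]
  | case5 i a l ih =>
    have h := ih fun t ht => hl t (by simp [ht])
    simp only [spinProd, List.map_cons, List.prod_cons] at h ⊢
    rw [h]
  | _ => rfl

/-- Every permutation is a product of transpositions of points that it moves. -/
theorem exists_swaps (c : Perm α) : ∃ l : List (α × α),
    (∀ p ∈ l, p.1 ≠ p.2 ∧ p.1 ∈ c.support ∧ p.2 ∈ c.support) ∧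
      (l.map fun p => swap p.1 p.2).prod = c := by
  -- Factoring inside the permutations of the support keeps the transpositions there.
  have key : ∀ σ : Perm {i // i ∈ c.support}, ∃ l : List (α × α),
      (∀ p ∈ l, p.1 ≠ p.2 ∧ p.1 ∈ c.support ∧ p.2 ∈ c.support) ∧
        (l.map fun p => swap p.1 p.2).prod = ofSubtype σ := by
    intro σ
    induction σ using swap_induction_on with
    | one => exact ⟨[], by simp⟩
    | swap_mul f a b hab ih =>
      obtain ⟨l, hl, hprod⟩ := ih
      refine ⟨(a.1, b.1) :: l, ?_, ?_⟩
      · rintro p (_ | ⟨_, hp⟩)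
        · exact ⟨fun h => hab (Subtype.ext h), a.2, b.2⟩
        · exact hl p hp
      · rw [List.map_cons, List.prod_cons, hprod, map_mul, ofSubtype_swap_eq]
  have h := key (c.subtypePerm fun i => by simp)
  rwa [ofSubtype_subtypePerm _ fun i hi => mem_support.2 hi] at h

/-- Conjugation of a word in `3`-cycles by an odd permutation `c` that agrees with the product of
the word on the support of `c` changes the sign of the product of the lifts. -/
theorem IsCliffordFamily.spinProd_conj [Algebra ℚ R] (he : IsCliffordFamily e) {c x : Perm α}
    (hodd : sign c = -1) (hcx : ∀ i ∈ c.support, c i = x i) (w : List (Perm α))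
    (hw : ∀ t ∈ w, t.IsThreeCycle) (hx : w.prod = x) :
    spinProd e (w.map fun t => c * t * c⁻¹) = -spinProd e w := by
  obtain ⟨l, hl, hc⟩ := exists_swaps c
  have hlen : (-1 : R) ^ l.length = -1 := by
    have h1 : sign c = (-1) ^ l.length := by
      rw [← hc, map_list_prod, List.map_map]
      have : ∀ p ∈ l, (sign ∘ fun p : α × α => swap p.1 p.2) p = -1 := fun p hp =>
        sign_swap (hl p hp).1
      rw [List.map_congr_left this, List.map_const', List.prod_replicate]
    rw [hodd] at h1
    rcases Nat.even_or_odd l.length with h | h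
    · rw [h.neg_one_pow] at h1
      exact absurd h1 (by decide)
    · exact h.neg_one_pow
  have hlne : ∀ p ∈ l, p.1 ≠ p.2 := fun p hp => (hl p hp).1
  have hC := he.pinProd_mul l hlne
  rw [hc] at hC
  have hmap : l.map (Prod.map x x) = l.map (Prod.map c c) :=
    List.map_congr_left fun p hp =>
      Prod.ext (hcx _ (hl p hp).2.1).symm (hcx _ (hl p hp).2.2).symm
  have hunit := he.isUnit_pinProd l hlne
  -- Move the lift `C` of `c` past itself: there is one sign for each of its oddly many roots.
  have h1 : pinProd e (l.map (Prod.map c c)) = -pinProd e l := by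
    have h := mul_pinProd_of_anticomm (e := e) (P := pinProd e l) (x := c)
      (fun i => by rw [hC, hlen, neg_one_mul]) l
    rw [hlen, neg_one_mul, ← neg_mul] at h
    rw [← neg_eq_iff_eq_neg]
    exact (hunit.mul_right_cancel h).symm
  -- Moving the lift of `x` past `C` applies `x` to the roots of `C`. There `x` acts as `c`, so the
  -- lifts of `x` and `c` anticommute.
  have h2 := mul_pinProd_of_comm (x := x) (fun i => hx ▸ he.spinProd_mul w hw i) l
  rw [hmap, h1, neg_mul] at h2
  have h3 := mul_spinProd_of_conj hC w
  have h4 : spinProd e (w.map fun t => c * t * c⁻¹) * pinProd e l =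
      -spinProd e w * pinProd e l := by
    rw [← h3, neg_mul, h2, neg_neg]
  exact hunit.mul_right_cancel h4

end SpinLift

/-- The standard basis is orthonormal for the sum of squares, and the Clifford algebra over `ℚ` is
nontrivial. -/
theorem exists_isCliffordFamily.{u} (α : Type u) [Finite α] [DecidableEq α] :
    ∃ (R : Type u) (_ : Ring R) (_ : Algebra ℚ R) (_ : Nontrivial R) (e : α → R),
      IsCliffordFamily e := by
  have := Fintype.ofFinite α
  let Q : QuadraticForm ℚ (α → ℚ) := QuadraticMap.weightedSumSquares ℚ fun _ : α => (1 : ℚ)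
  refine ⟨CliffordAlgebra Q, inferInstance, inferInstance, inferInstance,
    fun i => CliffordAlgebra.ι Q (Pi.single i 1), fun i => ?_, fun i j hij => ?_⟩
  · rw [CliffordAlgebra.ι_sq_scalar]
    simp [Q, QuadraticMap.weightedSumSquares_apply, Pi.single_apply]
  · apply CliffordAlgebra.ι_mul_ι_comm_of_isOrtho
    rw [QuadraticMap.isOrtho_def]
    simp only [Q, QuadraticMap.weightedSumSquares_apply, ← Finset.sum_add_distrib]
    refine Finset.sum_congr rfl fun k _ => ?_
    by_cases hi : k = i
    · subst hi
      simp [hij]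
    · simp [Pi.single_apply, hi]

/-! ### Permutations with odd cycles: merging and peeling. -/

section OddCycles

variable {α : Type*}

/-- All cycles of `x`, fixed points included, have odd length. -/
def HasOddCycles (x : Perm α) : Prop := ∀ y, ∃ m, Odd m ∧ (x ^ m) y = y

theorem HasOddCycles.one : HasOddCycles (1 : Perm α) := fun _ => ⟨1, odd_one, rfl⟩

theorem Equiv.Perm.isPeriodicPt_iff {x : Perm α} {m : ℕ} {y : α} :
    Function.IsPeriodicPt x m y ↔ (x ^ m) y = y := by
  rw [Function.IsPeriodicPt, Function.IsFixedPt, iterate_eq_pow]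

theorem Equiv.Perm.pow_minimalPeriod_apply (x : Perm α) (y : α) :
    (x ^ Function.minimalPeriod x y) y = y :=
  isPeriodicPt_iff.1 (Function.isPeriodicPt_minimalPeriod _ _)

theorem HasOddCycles.odd_minimalPeriod {x : Perm α} (hx : HasOddCycles x) (y : α) :
    Odd (Function.minimalPeriod x y) := by
  obtain ⟨m, hm, h⟩ := hx y
  exact hm.of_dvd_nat (isPeriodicPt_iff.2 h).minimalPeriod_dvd

theorem HasOddCycles.pow_two_pow_apply_ne {x : Perm α} (hx : HasOddCycles x) {y : α}
    (hy : x y ≠ y) (j : ℕ) : (x ^ 2 ^ j) y ≠ y := by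
  intro h
  have h1 := (isPeriodicPt_iff.2 h).minimalPeriod_dvd
  have h2 : (Function.minimalPeriod x y).Coprime (2 ^ j) :=
    (Nat.coprime_two_right.2 (hx.odd_minimalPeriod y)).pow_right j
  exact hy (Function.minimalPeriod_eq_one_iff_isFixedPt.1 (h2.eq_one_of_dvd h1))

theorem HasOddCycles.sq_ne {x : Perm α} (hx : HasOddCycles x) {y : α} (hy : x y ≠ y) :
    x (x y) ≠ y :=
  hx.pow_two_pow_apply_ne hy 1

theorem Equiv.Perm.SameCycle.exists_pow_lt_minimalPeriod [Finite α] {x : Perm α} {y z : α}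
    (h : x.SameCycle y z) : ∃ i < Function.minimalPeriod x y, (x ^ i) y = z := by
  obtain ⟨i, _, hi⟩ := h.exists_pow_eq'
  have hpos : 0 < Function.minimalPeriod x y :=
    Function.IsPeriodicPt.minimalPeriod_pos (orderOf_pos x)
      (isPeriodicPt_iff.2 (by rw [pow_orderOf_eq_one]; rfl))
  refine ⟨i % Function.minimalPeriod x y, Nat.mod_lt _ hpos, ?_⟩
  rw [← hi, ← iterate_eq_pow, ← iterate_eq_pow, Function.iterate_mod_minimalPeriod_eq]

theorem Equiv.Perm.pow_apply_ne_of_lt_minimalPeriod {x : Perm α} {y : α} {i : ℕ} (hi : 0 < i)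
    (hlt : i < Function.minimalPeriod x y) : (x ^ i) y ≠ y := fun h =>
  absurd (Function.IsPeriodicPt.minimalPeriod_le hi (isPeriodicPt_iff.2 h)) (not_le.2 hlt)

/-- If `t` fixes the points `x y, …, x ^ n y`, then `t * x` and `x` agree along them. -/
theorem Equiv.Perm.mul_pow_apply_of_fixed {t x : Perm α} {y : α} {n : ℕ}
    (h : ∀ i, 0 < i → i ≤ n → t ((x ^ i) y) = (x ^ i) y) : ((t * x) ^ n) y = (x ^ n) y := by
  induction n with
  | zero => rfl
  | succ n ih =>
    rw [pow_succ', Perm.mul_apply, ih fun i h0 hi => h i h0 (by omega), Perm.mul_apply,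
      ← Perm.mul_apply x, ← pow_succ', h _ (by omega) le_rfl]

theorem Equiv.Perm.IsThreeCycle.apply_apply_apply [Fintype α] [DecidableEq α] {t : Perm α}
    (ht : t.IsThreeCycle) (a : α) : t (t (t a)) = a := by
  have h := pow_orderOf_eq_one t
  rw [ht.orderOf] at h
  exact DFunLike.congr_fun h a

/-- If the points of the `3`-cycle `t` lie in distinct cycles of `x`, then `t` moves at most one
point of each cycle of `x`. -/
theorem apply_eq_of_sameCycle_of_isThreeCycle [Fintype α] [DecidableEq α] {x t : Perm α}
    (ht : t.IsThreeCycle) (hsep : ∀ a, t a ≠ a → ¬x.SameCycle a (t a)) {a : α} (ha : t a ≠ a)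
    (z : α) (hz : x.SameCycle a z) (hza : z ≠ a) : t z = z := by
  by_contra hne
  have hsupp := ht.support_eq_iff_mem_support.2 (mem_support.2 ha)
  have hzs := mem_support.2 hne
  rw [hsupp] at hzs
  simp only [Finset.mem_insert, Finset.mem_singleton] at hzs
  rcases hzs with h | h | h
  · exact hza h
  · exact hsep a ha (h ▸ hz)
  · have h1 : t z = a := by rw [h, ht.apply_apply_apply]
    exact hsep z hne (h1 ▸ hz.symm)

/-- The three cycles of `x` met by `t` merge into one, whose length is a sum of three odd numbers.
-/
theorem HasOddCycles.three_cycle_mul [Fintype α] [DecidableEq α] {x t : Perm α}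
    (hx : HasOddCycles x) (ht : t.IsThreeCycle) (hsep : ∀ a, t a ≠ a → ¬x.SameCycle a (t a)) :
    HasOddCycles (t * x) := by
  have ht3 := ht.apply_apply_apply
  have hfix := fun a ha => apply_eq_of_sameCycle_of_isThreeCycle (a := a) ht hsep ha
  have hstep : ∀ a, t a ≠ a → ∀ i < Function.minimalPeriod x a,
      ((t * x) ^ i) a = (x ^ i) a := by
    intro a ha i hi
    refine mul_pow_apply_of_fixed fun j h0 hj => hfix a ha _ (SameCycle.rfl.pow_right) ?_
    exact pow_apply_ne_of_lt_minimalPeriod h0 (by omega)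
  -- The walk from `a` follows the cycle of `x` until its last step, where `t` diverts it from `a`
  -- to `t a`.
  have hround : ∀ a, t a ≠ a → ((t * x) ^ Function.minimalPeriod x a) a = t a := by
    intro a ha
    have hpos := (hx.odd_minimalPeriod a).pos
    obtain ⟨n, hn⟩ := Nat.exists_eq_succ_of_ne_zero hpos.ne'
    have h1 := hstep a ha n (by omega)
    have h2 := x.pow_minimalPeriod_apply a
    rw [hn, pow_succ', Perm.mul_apply] at h2
    rw [hn, pow_succ', Perm.mul_apply, h1, Perm.mul_apply, h2]
  have hmoved : ∀ a, t a ≠ a → ∃ m, Odd m ∧ ((t * x) ^ m) a = a := by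
    intro a ha
    have hb : t (t a) ≠ t a := fun h => ha (t.injective h)
    have hc : t (t (t a)) ≠ t (t a) := fun h => hb (t.injective h)
    refine ⟨Function.minimalPeriod x (t (t a)) + (Function.minimalPeriod x (t a) +
      Function.minimalPeriod x a), ?_, ?_⟩
    · exact (hx.odd_minimalPeriod _).add_even
        ((hx.odd_minimalPeriod _).add_odd (hx.odd_minimalPeriod _))
    · rw [pow_add, pow_add, Perm.mul_apply, Perm.mul_apply, hround a ha, hround _ hb, hround _ hc,
        ht3]
  intro y
  by_cases hy : ∃ a, t a ≠ a ∧ x.SameCycle a y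
  · obtain ⟨a, ha, hay⟩ := hy
    obtain ⟨i, hi, rfl⟩ := hay.exists_pow_lt_minimalPeriod
    obtain ⟨m, hm, h⟩ := hmoved a ha
    refine ⟨m, hm, ?_⟩
    rw [← hstep a ha i hi, ← Perm.mul_apply, ← pow_add, add_comm, pow_add, Perm.mul_apply, h]
  · push Not at hy
    obtain ⟨m, hm, h⟩ := hx y
    refine ⟨m, hm, ?_⟩
    rw [mul_pow_apply_of_fixed, h]
    intro i _ _
    by_contra hne
    exact hy _ hne (SameCycle.rfl.pow_left)

/-- The `3`-cycle `y ↦ x y ↦ x (x y) ↦ y`. -/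
def consecutiveCycle [DecidableEq α] (x : Perm α) (y : α) : Perm α :=
  swap y (x y) * swap (x y) (x (x y))

namespace HasOddCycles

variable [DecidableEq α] {x : Perm α} {y : α}

theorem isThreeCycle_consecutiveCycle [Fintype α] (hx : HasOddCycles x) (hy : x y ≠ y) :
    (consecutiveCycle x y).IsThreeCycle := by
  rw [consecutiveCycle, swap_comm]
  exact isThreeCycle_swap_mul_swap_same hy (fun h => hy (x.injective h.symm)) (hx.sq_ne hy).symm

theorem consecutiveCycle_apply (hx : HasOddCycles x) (hy : x y ≠ y) :
    consecutiveCycle x y y = x y := by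
  rw [consecutiveCycle, Perm.mul_apply, swap_apply_of_ne_of_ne hy.symm (hx.sq_ne hy).symm,
    swap_apply_left]

theorem consecutiveCycle_apply_apply (hx : HasOddCycles x) (hy : x y ≠ y) :
    consecutiveCycle x y (x y) = x (x y) := by
  rw [consecutiveCycle, Perm.mul_apply, swap_apply_left,
    swap_apply_of_ne_of_ne (hx.sq_ne hy) fun h => hy (x.injective h)]

theorem consecutiveCycle_apply_sq : consecutiveCycle x y (x (x y)) = y := by
  rw [consecutiveCycle, Perm.mul_apply, swap_apply_right, swap_apply_right]

theorem consecutiveCycle_apply_of_ne {z : α} (h0 : z ≠ y) (h1 : z ≠ x y) (h2 : z ≠ x (x y)) :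
    consecutiveCycle x y z = z := by
  rw [consecutiveCycle, Perm.mul_apply, swap_apply_of_ne_of_ne h1 h2,
    swap_apply_of_ne_of_ne h0 h1]

theorem consecutiveCycle_inv_mul_apply (hx : HasOddCycles x) (hy : x y ≠ y) :
    ((consecutiveCycle x y)⁻¹ * x) y = y := by
  rw [Perm.mul_apply, Perm.inv_eq_iff_eq, hx.consecutiveCycle_apply hy]

theorem consecutiveCycle_inv_mul_apply_apply (hx : HasOddCycles x) (hy : x y ≠ y) :
    ((consecutiveCycle x y)⁻¹ * x) (x y) = x y := by
  rw [Perm.mul_apply, Perm.inv_eq_iff_eq, hx.consecutiveCycle_apply_apply hy]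

/-- Peeling makes `y` and `x y` fixed points and shortens their cycle by two, which keeps its length
odd. -/
theorem consecutiveCycle_inv_mul [Finite α] (hx : HasOddCycles x) (hy : x y ≠ y) :
    HasOddCycles ((consecutiveCycle x y)⁻¹ * x) := by
  set t := consecutiveCycle x y with ht
  have h0 := hx.consecutiveCycle_inv_mul_apply hy
  have h1 := hx.consecutiveCycle_inv_mul_apply_apply hy
  have hfix : ∀ z, z ≠ y → z ≠ x y → z ≠ x (x y) → t⁻¹ z = z := by
    intro z h0 h1 h2
    rw [Perm.inv_eq_iff_eq, ht, consecutiveCycle_apply_of_ne h0 h1 h2]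
  intro z
  by_cases hz : x.SameCycle y z
  · obtain ⟨i, hi, rfl⟩ := hz.exists_pow_lt_minimalPeriod
    have hodd := hx.odd_minimalPeriod y
    rcases i with _ | _ | i
    · exact ⟨1, odd_one, h0⟩
    · exact ⟨1, odd_one, h1⟩
    have hne : ∀ {j k : ℕ}, j < k → k < Function.minimalPeriod x y → (x ^ k) y ≠ (x ^ j) y := by
      intro j k hjk hk h
      obtain ⟨m, rfl⟩ := Nat.exists_eq_add_of_lt hjk
      rw [add_assoc, pow_add, Perm.mul_apply] at h
      exact pow_apply_ne_of_lt_minimalPeriod (by omega) (by omega) ((x ^ j).injective h)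
    have hstep : ∀ j, j + 2 < Function.minimalPeriod x y →
        ((t⁻¹ * x) ^ j) (x (x y)) = (x ^ (j + 2)) y := by
      intro j hj
      rw [pow_add, Perm.mul_apply]
      refine mul_pow_apply_of_fixed fun k hk0 hk => ?_
      have h3 : (x ^ k) (x (x y)) = (x ^ (k + 2)) y := by rw [pow_add]; rfl
      rw [h3]
      exact hfix _ (hne (j := 0) (by omega) (by omega)) (hne (j := 1) (by omega) (by omega))
        (hne (j := 2) (by omega) (by omega))
    obtain ⟨m, hm⟩ : ∃ m, Function.minimalPeriod x y = m + 3 :=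
      ⟨Function.minimalPeriod x y - 3, by omega⟩
    have hround : ((t⁻¹ * x) ^ (m + 1)) (x (x y)) = x (x y) := by
      rw [pow_succ', Perm.mul_apply, hstep m (by omega), Perm.mul_apply, ← Perm.mul_apply x,
        ← pow_succ', ← hm, pow_minimalPeriod_apply, Perm.inv_eq_iff_eq, ht,
        consecutiveCycle_apply_sq]
    refine ⟨m + 1, ?_, ?_⟩
    · rw [hm] at hodd
      grind
    · rw [← hstep i hi, ← Perm.mul_apply, ← pow_add, add_comm, pow_add, Perm.mul_apply, hround]
  · obtain ⟨m, hm, h⟩ := hx z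
    refine ⟨m, hm, ?_⟩
    rw [mul_pow_apply_of_fixed, h]
    intro i _ _
    refine hfix _ ?_ ?_ ?_ <;> intro h <;> apply hz
    · exact (h ▸ SameCycle.rfl.pow_right : x.SameCycle z y).symm
    · exact sameCycle_apply_left.1 (h ▸ SameCycle.rfl.pow_right : x.SameCycle z (x y)).symm
    · exact sameCycle_apply_left.1 (sameCycle_apply_left.1
        (h ▸ SameCycle.rfl.pow_right : x.SameCycle z (x (x y))).symm)

end HasOddCycles

end OddCycles

/-! ### Counting cycles by the dimension of the space of invariant functions. -/

section InvariantFunctions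

variable {α : Type*}

/-- The functions that are constant on the cycles of `x`. -/
def invariantFunctions (x : Perm α) : Submodule ℚ (α → ℚ) where
  carrier := {f | ∀ i, f (x i) = f i}
  add_mem' hf hg i := by simp [hf i, hg i]
  zero_mem' _ := rfl
  smul_mem' c f hf i := by simp [hf i]

/-- The number of cycles of `x`, fixed points included. -/
noncomputable def numCycles (x : Perm α) : ℕ := Module.finrank ℚ (invariantFunctions x)

theorem mem_invariantFunctions {x : Perm α} {f : α → ℚ} :
    f ∈ invariantFunctions x ↔ ∀ i, f (x i) = f i := Iff.rfl

theorem eq_of_sameCycle {x : Perm α} {f : α → ℚ} (hf : f ∈ invariantFunctions x) {i j : α}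
    (h : x.SameCycle i j) : f i = f j := by
  obtain ⟨n, rfl⟩ := h
  induction n using Int.induction_on with
  | zero => rfl
  | succ n ih => rw [ih, add_comm, zpow_add, zpow_one, Perm.mul_apply, hf]
  | pred n ih =>
    rw [ih, ← hf ((x ^ (-(n : ℤ) - 1)) i), ← Perm.mul_apply, ← zpow_one_add, add_sub_cancel]

theorem numCycles_one [Fintype α] : numCycles (1 : Perm α) = Fintype.card α := by
  have : invariantFunctions (1 : Perm α) = ⊤ := by
    ext f
    simp [mem_invariantFunctions]
  rw [numCycles, this, finrank_top, Module.finrank_fintype_fun_eq_card]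

theorem numCycles_lt [Fintype α] {x : Perm α} (hx : x ≠ 1) : numCycles x < Fintype.card α := by
  classical
  rw [← Module.finrank_fintype_fun_eq_card (R := ℚ) (η := α)]
  refine Submodule.finrank_lt fun h => hx ?_
  ext i
  have hi : Pi.single i (1 : ℚ) ∈ invariantFunctions x := h ▸ Submodule.mem_top
  have := hi i
  by_contra hne
  rw [Pi.single_eq_same, Pi.single_eq_of_ne (show x i ≠ i from hne)] at this
  exact zero_ne_one this

/-- The functions of `W` that take the same value at `a` and `b`. -/
def equalizerSubmodule (W : Submodule ℚ (α → ℚ)) (a b : α) : Submodule ℚ (α → ℚ) :=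
  W ⊓ LinearMap.ker (LinearMap.proj (R := ℚ) (φ := fun _ : α => ℚ) a - LinearMap.proj b)

theorem mem_equalizerSubmodule {W : Submodule ℚ (α → ℚ)} {a b : α} {f : α → ℚ} :
    f ∈ equalizerSubmodule W a b ↔ f ∈ W ∧ f a = f b := by
  simp [equalizerSubmodule, sub_eq_zero]

theorem finrank_le_finrank_equalizerSubmodule [Finite α] (W : Submodule ℚ (α → ℚ)) (a b : α) :
    Module.finrank ℚ W ≤ Module.finrank ℚ (equalizerSubmodule W a b) + 1 := by
  let φ : (α → ℚ) →ₗ[ℚ] ℚ := LinearMap.proj (R := ℚ) (φ := fun _ : α => ℚ) a - LinearMap.proj b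
  have h1 := (φ.domRestrict W).finrank_range_add_finrank_ker
  have h2 : Module.finrank ℚ (LinearMap.range (φ.domRestrict W)) ≤ 1 :=
    (Submodule.finrank_le _).trans (Module.finrank_self ℚ).le
  have h3 : (LinearMap.ker (φ.domRestrict W)).map W.subtype = equalizerSubmodule W a b := by
    ext f
    simp only [Submodule.mem_map, LinearMap.mem_ker, Submodule.subtype_apply, Subtype.exists,
      mem_equalizerSubmodule]
    constructor
    · rintro ⟨g, hg, h, rfl⟩
      exact ⟨hg, sub_eq_zero.1 h⟩
    · rintro ⟨hf, h⟩
      exact ⟨f, hf, sub_eq_zero.2 h, rfl⟩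
  have h4 := Submodule.finrank_map_subtype_eq W (LinearMap.ker (φ.domRestrict W))
  rw [h3] at h4
  omega

theorem mem_invariantFunctions_mul [Fintype α] [DecidableEq α] {x t : Perm α}
    (ht : t.IsThreeCycle) {a : α} (ha : t a ≠ a) {f : α → ℚ} (hf : f ∈ invariantFunctions x)
    (h1 : f a = f (t a)) (h2 : f a = f (t (t a))) : f ∈ invariantFunctions (t * x) := by
  have ht3 := ht.apply_apply_apply a
  have hsupp := ht.support_eq_iff_mem_support.2 (mem_support.2 ha)
  have hft : ∀ z, f (t z) = f z := by
    intro z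
    by_cases hz : z ∈ t.support
    · rw [hsupp] at hz
      simp only [Finset.mem_insert, Finset.mem_singleton] at hz
      rcases hz with rfl | rfl | rfl
      · exact h1.symm
      · rw [← h2, h1]
      · rw [ht3, h2]
    · rw [notMem_support.1 hz]
  intro i
  rw [Perm.mul_apply, hft, hf]

theorem exists_apply_ne_of_isThreeCycle [Fintype α] [DecidableEq α] {t : Perm α}
    (ht : t.IsThreeCycle) : ∃ a, t a ≠ a := by
  by_contra! h
  exact ht.ne_one (Perm.ext h)

/-- An `x`-invariant function is `t * x`-invariant once it is constant on the three points of `t`: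
two linear conditions. If two of these points share a cycle of `x`, one condition is automatic,
whence the sharper bound in the next lemma. -/
theorem numCycles_le_three_cycle_mul [Fintype α] [DecidableEq α] (x : Perm α) {t : Perm α}
    (ht : t.IsThreeCycle) : numCycles x ≤ numCycles (t * x) + 2 := by
  obtain ⟨a, ha⟩ := exists_apply_ne_of_isThreeCycle ht
  have h1 := finrank_le_finrank_equalizerSubmodule (invariantFunctions x) a (t a)
  have h2 := finrank_le_finrank_equalizerSubmodule
    (equalizerSubmodule (invariantFunctions x) a (t a)) a (t (t a))
  have h3 : Module.finrank ℚ (equalizerSubmodule (equalizerSubmodule (invariantFunctions x)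
      a (t a)) a (t (t a))) ≤ numCycles (t * x) := by
    refine Submodule.finrank_mono fun f hf => ?_
    rw [mem_equalizerSubmodule, mem_equalizerSubmodule] at hf
    exact mem_invariantFunctions_mul ht ha hf.1.1 hf.1.2 hf.2
  rw [numCycles]
  omega

theorem numCycles_le_three_cycle_mul_of_sameCycle [Fintype α] [DecidableEq α] {x t : Perm α}
    (ht : t.IsThreeCycle) {a : α} (ha : t a ≠ a) (hsame : x.SameCycle a (t a)) :
    numCycles x ≤ numCycles (t * x) + 1 := by
  have h1 := finrank_le_finrank_equalizerSubmodule (invariantFunctions x) a (t (t a))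
  have h2 : Module.finrank ℚ (equalizerSubmodule (invariantFunctions x) a (t (t a))) ≤
      numCycles (t * x) := by
    refine Submodule.finrank_mono fun f hf => ?_
    rw [mem_equalizerSubmodule] at hf
    exact mem_invariantFunctions_mul ht ha hf.1 (eq_of_sameCycle hf.1 hsame) hf.2
  rw [numCycles]
  omega

theorem HasOddCycles.numCycles_consecutiveCycle_inv_mul [Finite α] [DecidableEq α]
    {x : Perm α} {y : α} (hx : HasOddCycles x) (hy : x y ≠ y) :
    numCycles x + 2 ≤ numCycles ((consecutiveCycle x y)⁻¹ * x) := by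
  set t := consecutiveCycle x y with ht
  set V := invariantFunctions (t⁻¹ * x) with hV
  have hsq := hx.sq_ne hy
  have hsq' : x (x y) ≠ x y := fun h => hy (x.injective h)
  have hsingle : ∀ b, (t⁻¹ * x) b = b → Pi.single b (1 : ℚ) ∈ V := by
    intro b hb i
    by_cases hi : i = b
    · rw [hi, hb]
    · rw [Pi.single_eq_of_ne hi, Pi.single_eq_of_ne]
      exact fun h => hi ((t⁻¹ * x).injective (h.trans hb.symm))
  -- The indicators of the new fixed points `y` and `x y` witness the two strict inclusions.
  have h1 : equalizerSubmodule V y (x (x y)) < V := by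
    refine lt_of_le_of_ne inf_le_left fun h => ?_
    have hm := hsingle y (hx.consecutiveCycle_inv_mul_apply hy)
    rw [← h, mem_equalizerSubmodule, Pi.single_eq_same, Pi.single_eq_of_ne hsq] at hm
    exact one_ne_zero hm.2
  have h2 : equalizerSubmodule (equalizerSubmodule V y (x (x y))) (x y) (x (x y)) <
      equalizerSubmodule V y (x (x y)) := by
    refine lt_of_le_of_ne inf_le_left fun h => ?_
    have hm : Pi.single (x y) (1 : ℚ) ∈ equalizerSubmodule V y (x (x y)) := by
      rw [mem_equalizerSubmodule, Pi.single_eq_of_ne hy.symm, Pi.single_eq_of_ne hsq']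
      exact ⟨hsingle _ (hx.consecutiveCycle_inv_mul_apply_apply hy), rfl⟩
    rw [← h, mem_equalizerSubmodule, Pi.single_eq_same, Pi.single_eq_of_ne hsq'] at hm
    exact one_ne_zero hm.2
  have h3 : invariantFunctions x ≤
      equalizerSubmodule (equalizerSubmodule V y (x (x y))) (x y) (x (x y)) := by
    intro f hf
    rw [mem_equalizerSubmodule, mem_equalizerSubmodule]
    have hft : ∀ z, f (t z) = f z := by
      intro z
      by_cases h0 : z = y
      · rw [h0, ht, hx.consecutiveCycle_apply hy, hf]
      by_cases h1 : z = x y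
      · rw [h1, ht, hx.consecutiveCycle_apply_apply hy, hf]
      by_cases h2 : z = x (x y)
      · rw [h2, ht, HasOddCycles.consecutiveCycle_apply_sq, hf, hf]
      · rw [ht, HasOddCycles.consecutiveCycle_apply_of_ne h0 h1 h2]
    refine ⟨⟨fun i => ?_, by rw [hf, hf]⟩, by rw [hf (x y)]⟩
    rw [← hft, ← Perm.mul_apply, mul_inv_cancel_left, hf]
  have h4 := Submodule.finrank_mono h3
  have h5 := Submodule.finrank_lt_finrank_of_lt h2
  have h6 := Submodule.finrank_lt_finrank_of_lt h1
  rw [numCycles, numCycles, ← hV]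
  omega

end InvariantFunctions

/-! ### Words of extremal length. -/

section SeparatedWords

variable {α : Type*} [Fintype α] [DecidableEq α]

/-- A word in `3`-cycles each of which merges three cycles of the product of the letters that
follow it. -/
def IsSeparatedWord (w : List (Perm α)) : Prop :=
  (∀ t ∈ w, t.IsThreeCycle) ∧ numCycles w.prod + 2 * w.length = Fintype.card α

theorem card_le_numCycles_prod_add (w : List (Perm α)) (hw : ∀ t ∈ w, t.IsThreeCycle) :
    Fintype.card α ≤ numCycles w.prod + 2 * w.length := by
  induction w with
  | nil => simp [numCycles_one]
  | cons t w ih =>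
    have h1 := ih fun s hs => hw s (by simp [hs])
    have h2 := numCycles_le_three_cycle_mul w.prod (hw t (by simp))
    rw [List.prod_cons, List.length_cons]
    omega

namespace IsSeparatedWord

variable {t : Perm α} {w : List (Perm α)}

theorem tail (h : IsSeparatedWord (t :: w)) : IsSeparatedWord w := by
  have hw : ∀ s ∈ w, s.IsThreeCycle := fun s hs => h.1 s (by simp [hs])
  refine ⟨hw, le_antisymm ?_ (card_le_numCycles_prod_add w hw)⟩
  have h1 := h.2
  have h2 := numCycles_le_three_cycle_mul w.prod (h.1 t (by simp))
  rw [List.prod_cons, List.length_cons] at h1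
  omega

/-- In an extremal word each letter must lose exactly two cycles; two points in one cycle would lose
at most one. -/
theorem not_sameCycle (h : IsSeparatedWord (t :: w)) {a : α} (ha : t a ≠ a) :
    ¬w.prod.SameCycle a (t a) := by
  intro hsame
  have h1 := h.2
  have h2 := h.tail.2
  have h3 := numCycles_le_three_cycle_mul_of_sameCycle (h.1 t (by simp)) ha hsame
  rw [List.prod_cons, List.length_cons] at h1
  omega

theorem hasOddCycles (h : IsSeparatedWord w) : HasOddCycles w.prod := by
  induction w with
  | nil => exact HasOddCycles.one
  | cons t w ih =>
    rw [List.prod_cons]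
    exact (ih h.tail).three_cycle_mul (h.1 t (by simp)) fun _ ha => h.not_sameCycle ha

end IsSeparatedWord

theorem HasOddCycles.isSeparatedWord_consecutiveCycle_cons {x : Perm α} (hx : HasOddCycles x)
    {y : α} (hy : x y ≠ y) {w : List (Perm α)} (hw : IsSeparatedWord w)
    (hprod : w.prod = (consecutiveCycle x y)⁻¹ * x) :
    IsSeparatedWord (consecutiveCycle x y :: w) ∧ (consecutiveCycle x y :: w).prod = x := by
  have hp : (consecutiveCycle x y :: w).prod = x := by
    rw [List.prod_cons, hprod, mul_inv_cancel_left]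
  have h3 : ∀ t ∈ consecutiveCycle x y :: w, t.IsThreeCycle := by
    rintro t (_ | ⟨_, ht⟩)
    exacts [hx.isThreeCycle_consecutiveCycle hy, hw.1 t ht]
  refine ⟨⟨h3, le_antisymm ?_ (card_le_numCycles_prod_add _ h3)⟩, hp⟩
  have h1 := hx.numCycles_consecutiveCycle_inv_mul hy
  have h2 := hw.2
  rw [hprod] at h2
  rw [hp, List.length_cons]
  omega

theorem HasOddCycles.exists_isSeparatedWord {x : Perm α} (hx : HasOddCycles x) :
    ∃ w, IsSeparatedWord w ∧ w.prod = x := by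
  induction hn : Fintype.card α - numCycles x using Nat.strong_induction_on generalizing x with
  | _ n ih =>
    by_cases h1 : x = 1
    · exact ⟨[], ⟨by simp, by simp [numCycles_one]⟩, by simp [h1]⟩
    obtain ⟨y, hy⟩ : ∃ y, x y ≠ y := by
      by_contra! h
      exact h1 (Perm.ext h)
    have h2 := numCycles_lt h1
    have h3 := hx.numCycles_consecutiveCycle_inv_mul hy
    obtain ⟨w, hw, hp⟩ := ih _ (by omega) (hx.consecutiveCycle_inv_mul hy) rfl
    exact ⟨_, hx.isSeparatedWord_consecutiveCycle_cons hy hw hp⟩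

theorem HasOddCycles.exists_isSeparatedWord_cons {x : Perm α} (hx : HasOddCycles x) {y : α}
    (hy : x y ≠ y) : ∃ w, IsSeparatedWord (consecutiveCycle x y :: w) ∧
      (consecutiveCycle x y :: w).prod = x := by
  obtain ⟨w, hw, hp⟩ := (hx.consecutiveCycle_inv_mul hy).exists_isSeparatedWord
  exact ⟨w, hx.isSeparatedWord_consecutiveCycle_cons hy hw hp⟩

end SeparatedWords

/-! ### Hurwitz equivalence of lists and its relation to the braid group action. -/

section HurwitzEquiv

variable {G : Type*} [Group G]

/-- Out-of-range moves do nothing, so `HurwitzEquiv` may allow every index and still describe braid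
orbits. -/
theorem hurwitzMove_eq_self {i : ℕ} {l : List G} (h : l.length ≤ i + 1) :
    hurwitzMove i l = l := by
  fun_induction hurwitzMove i l with
  | case3 a b l => simp at h
  | case5 i a l ih => rw [ih (by simpa using h)]
  | _ => rfl

/-- Two words are Hurwitz equivalent if they are connected by Hurwitz operators and their
inverses. -/
def HurwitzEquiv : List G → List G → Prop :=
  Relation.EqvGen fun l l' => ∃ i, l' = hurwitzMove i l

namespace HurwitzEquiv

theorem refl (l : List G) : HurwitzEquiv l l := Relation.EqvGen.refl l

theorem symm {l m : List G} (h : HurwitzEquiv l m) : HurwitzEquiv m l := Relation.EqvGen.symm _ _ h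

theorem trans {l m n : List G} (h : HurwitzEquiv l m) (h' : HurwitzEquiv m n) :
    HurwitzEquiv l n := Relation.EqvGen.trans _ _ _ h h'

theorem move (i : ℕ) (l : List G) : HurwitzEquiv l (hurwitzMove i l) :=
  Relation.EqvGen.rel _ _ ⟨i, rfl⟩

theorem cons (a : G) {l m : List G} (h : HurwitzEquiv l m) : HurwitzEquiv (a :: l) (a :: m) := by
  induction h with
  | rel l m h =>
    obtain ⟨i, rfl⟩ := h
    exact move (i + 1) (a :: l)
  | refl l => exact refl _
  | symm l m _ ih => exact ih.symm
  | trans l m n _ _ ih ih' => exact ih.trans ih'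

theorem length_eq {l m : List G} (h : HurwitzEquiv l m) : l.length = m.length := by
  induction h with
  | rel l m h =>
    obtain ⟨i, rfl⟩ := h
    exact (hurwitzMove_length i l).symm
  | refl l => rfl
  | symm l m _ ih => exact ih.symm
  | trans l m n _ _ ih ih' => exact ih.trans ih'

theorem prod_eq {l m : List G} (h : HurwitzEquiv l m) : l.prod = m.prod := by
  induction h with
  | rel l m h =>
    obtain ⟨i, rfl⟩ := h
    exact (hurwitzMove_prod i l).symm
  | refl l => rfl
  | symm l m _ ih => exact ih.symm
  | trans l m n _ _ ih ih' => exact ih.trans ih'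

theorem forall_mem_iff {T : Set G} (hT : ∀ g : G, ∀ t ∈ T, g * t * g⁻¹ ∈ T) {l m : List G}
    (h : HurwitzEquiv l m) : (∀ t ∈ l, t ∈ T) ↔ ∀ t ∈ m, t ∈ T := by
  induction h with
  | rel l m h =>
    obtain ⟨i, rfl⟩ := h
    refine ⟨hurwitzMove_mem hT i l, fun h => ?_⟩
    rw [← hurwitzMoveInv_move i l]
    exact hurwitzMoveInv_mem hT i _ h
  | refl l => exact Iff.rfl
  | symm l m _ ih => exact ih.symm
  | trans l m n _ _ ih ih' => exact ih.trans ih'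

/-- Lifting in both directions at once lets the induction pass through symmetry. This brings
equivalences of words of permutations back to the alternating group. -/
theorem exists_of_map {H : Type*} [Group H] (f : G →* H) {l m : List H} (h : HurwitzEquiv l m) :
    (∀ l', l = l'.map f → ∃ m', m = m'.map f ∧ HurwitzEquiv l' m') ∧
      (∀ m', m = m'.map f → ∃ l', l = l'.map f ∧ HurwitzEquiv l' m') := by
  have hmove : ∀ (i : ℕ) (l : List G), hurwitzMove i (l.map f) = (hurwitzMove i l).map f := by
    intro i l
    fun_induction hurwitzMove i l <;> simp_all [hurwitzMove]
  induction h with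
  | rel l m h =>
    obtain ⟨i, rfl⟩ := h
    refine ⟨?_, ?_⟩
    · rintro l' rfl
      exact ⟨_, hmove i l', move i l'⟩
    · intro m' hm'
      refine ⟨hurwitzMoveInv i m', ?_, ?_⟩
      · rw [← hurwitzMoveInv_move i l, hm',
          ← hurwitzMoveInv_move i ((hurwitzMoveInv i m').map f), hmove, hurwitzMove_moveInv]
      · have := move i (hurwitzMoveInv i m')
        rwa [hurwitzMove_moveInv] at this
  | refl l => exact ⟨fun l' h => ⟨l', h, refl _⟩, fun l' h => ⟨l', h, refl _⟩⟩
  | symm l m _ ih =>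
    refine ⟨fun l' h => ?_, fun l' h => ?_⟩
    · obtain ⟨m', h1, h2⟩ := ih.2 l' h
      exact ⟨m', h1, h2.symm⟩
    · obtain ⟨m', h1, h2⟩ := ih.1 l' h
      exact ⟨m', h1, h2.symm⟩
  | trans l m n _ _ ih ih' =>
    refine ⟨fun l' h => ?_, fun l' h => ?_⟩
    · obtain ⟨m', h1, h2⟩ := ih.1 l' h
      obtain ⟨n', h3, h4⟩ := ih'.1 m' h1
      exact ⟨n', h3, h2.trans h4⟩
    · obtain ⟨m', h1, h2⟩ := ih'.2 l' h
      obtain ⟨n', h3, h4⟩ := ih.2 m' h1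
      exact ⟨n', h3, h4.trans h2⟩

theorem of_map {H : Type*} [Group H] {f : G →* H} (hf : Function.Injective f) {l m : List G}
    (h : HurwitzEquiv (l.map f) (m.map f)) : HurwitzEquiv l m := by
  obtain ⟨m', h1, h2⟩ := (h.exists_of_map f).1 l rfl
  rwa [hf.list_map h1]

theorem exists_smul_eq {k : ℕ} {l m : List G} (h : HurwitzEquiv l m) (hl : l.length = k)
    (hm : m.length = k) : ∃ b : BraidGroup k, b • (⟨l, hl⟩ : GroupWord G k) = ⟨m, hm⟩ := by
  induction h with
  | rel l m h =>
    obtain ⟨i, rfl⟩ := h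
    by_cases hi : i < k - 1
    · exact ⟨PresentedGroup.of ⟨i, hi⟩, Subtype.ext (hurwitz_of_smul _ _ _)⟩
    · refine ⟨1, ?_⟩
      rw [one_smul]
      apply Subtype.ext
      have hle : l.length ≤ i + 1 := by omega
      exact (hurwitzMove_eq_self hle).symm
  | refl l => exact ⟨1, one_smul _ _⟩
  | symm l m _ ih =>
    obtain ⟨b, hb⟩ := ih hm hl
    exact ⟨b⁻¹, by rw [← hb, inv_smul_smul]⟩
  | trans l m n h _ ih ih' =>
    have hmk : m.length = k := (length_eq h).symm.trans hl
    obtain ⟨b, hb⟩ := ih hl hmk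
    obtain ⟨c, hc⟩ := ih' hmk hm
    exact ⟨c * b, by rw [mul_smul, hb, hc]⟩

end HurwitzEquiv

end HurwitzEquiv

/-! ### Hurwitz connectedness of separated words. -/

section Transitivity

variable {α : Type*} [Fintype α] [DecidableEq α]

theorem IsSeparatedWord.of_hurwitzEquiv {l m : List (Perm α)} (hl : IsSeparatedWord l)
    (h : HurwitzEquiv l m) : IsSeparatedWord m := by
  have hT : ∀ g : Perm α, ∀ t ∈ {t : Perm α | t.IsThreeCycle}, g * t * g⁻¹ ∈
      {t : Perm α | t.IsThreeCycle} := by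
    intro g t ht
    simpa [IsThreeCycle, cycleType_conj] using ht
  exact ⟨(h.forall_mem_iff hT).1 hl.1, by rw [← h.prod_eq, ← h.length_eq]; exact hl.2⟩

/-- Separated words of length `k` with the same product are Hurwitz equivalent. -/
def HurwitzConnected (α : Type*) [Fintype α] [DecidableEq α] (k : ℕ) : Prop :=
  ∀ v v' : List (Perm α), v.length = k → IsSeparatedWord v → IsSeparatedWord v' →
    v.prod = v'.prod → HurwitzEquiv v v'

namespace HurwitzConnected

variable {k : ℕ} {x : Perm α}

theorem cons (ih : HurwitzConnected α k) {t : Perm α} {u v : List (Perm α)} (hk : u.length = k)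
    (hu : IsSeparatedWord (t :: u)) (hv : IsSeparatedWord (t :: v))
    (huv : (t :: u).prod = (t :: v).prod) : HurwitzEquiv (t :: u) (t :: v) := by
  refine (ih u v hk hu.tail hv.tail ?_).cons t
  rw [List.prod_cons, List.prod_cons] at huv
  exact mul_left_cancel huv

/-- The product of `u` agrees with `x` at `z` and `x z`, so both have the same consecutive cycle at
`z`. By induction `u` can be made to start with it, and one Hurwitz move carries it past `t`. -/
theorem exists_consecutiveCycle_cons_of_fixed (ih : HurwitzConnected α k) {t : Perm α}
    {u : List (Perm α)} (hu : IsSeparatedWord (t :: u)) (hx : (t :: u).prod = x)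
    (hk : u.length = k) {z : α} (hz : x z ≠ z) (h1 : t (x z) = x z) (h2 : t (x (x z)) = x (x z)) :
    ∃ v, HurwitzEquiv (t :: u) (consecutiveCycle x z :: v) := by
  rw [List.prod_cons] at hx
  have hux : ∀ a, t (x a) = x a → u.prod a = x a := by
    intro a ha
    apply t.injective
    rw [ha, ← Perm.mul_apply, hx]
  have hT : consecutiveCycle u.prod z = consecutiveCycle x z := by
    rw [consecutiveCycle, hux z h1, hux (x z) h2, consecutiveCycle]
  obtain ⟨v, hv, hvu⟩ := hu.tail.hasOddCycles.exists_isSeparatedWord_cons (y := z)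
    (by rwa [hux z h1])
  rw [hT] at hv hvu
  exact ⟨_, ((ih u _ hk hu.tail hv hvu.symm).cons t).trans (HurwitzEquiv.move 0 _)⟩

theorem exists_consecutiveCycle_cons (ih : HurwitzConnected α k) {t : Perm α}
    {u : List (Perm α)} (hu : IsSeparatedWord (t :: u)) (hx : (t :: u).prod = x)
    (hk : u.length = k) : ∃ y v, x y ≠ y ∧ HurwitzEquiv (t :: u) (consecutiveCycle x y :: v) := by
  have ht := hu.1 t (by simp)
  have hxu := hx
  rw [List.prod_cons] at hxu
  by_cases hu1 : u.prod = 1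
  · have hnil : u = [] := by
      have := hu.tail.2
      rw [hu1, numCycles_one] at this
      exact List.eq_nil_of_length_eq_zero (by omega)
    subst hnil
    rw [List.prod_nil, mul_one] at hxu
    subst hxu
    obtain ⟨a, ha⟩ := exists_apply_ne_of_isThreeCycle ht
    refine ⟨a, [], ha, ?_⟩
    rw [consecutiveCycle, ← ht.eq_swap_mul_swap_iff_mem_support.2 (mem_support.2 ha)]
    exact HurwitzEquiv.refl _
  have hodd := hu.tail.hasOddCycles
  -- If `t` meets a nontrivial cycle of `u.prod` at `a`, it moves no other point of that cycle, so
  -- `y = a` works. Otherwise `t` is disjoint from `u.prod` and any moved point works.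
  obtain ⟨y, hy, h1, h2⟩ : ∃ y, u.prod y ≠ y ∧ t (u.prod y) = u.prod y ∧
      t (u.prod (u.prod y)) = u.prod (u.prod y) := by
    by_cases h : ∃ a, t a ≠ a ∧ u.prod a ≠ a
    · obtain ⟨a, ha, hua⟩ := h
      have hfix := apply_eq_of_sameCycle_of_isThreeCycle ht (fun _ => hu.not_sameCycle) ha
      exact ⟨a, hua, hfix _ (sameCycle_apply_right.2 SameCycle.rfl) hua,
        hfix _ (sameCycle_apply_right.2 (sameCycle_apply_right.2 SameCycle.rfl))
          (hodd.sq_ne hua)⟩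
    · push Not at h
      obtain ⟨y, hy⟩ : ∃ y, u.prod y ≠ y := by
        by_contra! h
        exact hu1 (Perm.ext h)
      have hy2 : u.prod (u.prod y) ≠ u.prod y := fun h => hy (u.prod.injective h)
      have hy3 : u.prod (u.prod (u.prod y)) ≠ u.prod (u.prod y) :=
        fun h => hy2 (u.prod.injective h)
      exact ⟨y, hy, not_not.1 fun h' => hy2 (h _ h'), not_not.1 fun h' => hy3 (h _ h')⟩
  have hxy : x y = u.prod y := by rw [← hxu, Perm.mul_apply, h1]
  have hxxy : x (x y) = u.prod (u.prod y) := by rw [hxy, ← hxu, Perm.mul_apply, h2]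
  obtain ⟨v, hv⟩ := ih.exists_consecutiveCycle_cons_of_fixed hu hx hk (z := y) (by rwa [hxy])
    (by rw [hxy, h1]) (by rw [hxxy, h2])
  exact ⟨y, v, by rwa [hxy], hv⟩

/-- The words starting with `consecutiveCycle x y` are Hurwitz equivalent to those starting with
`consecutiveCycle x z`. -/
def Linked (x : Perm α) (y z : α) : Prop :=
  ∀ u v : List (Perm α), IsSeparatedWord (consecutiveCycle x y :: u) →
    (consecutiveCycle x y :: u).prod = x → IsSeparatedWord (consecutiveCycle x z :: v) →
    (consecutiveCycle x z :: v).prod = x →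
    HurwitzEquiv (consecutiveCycle x y :: u) (consecutiveCycle x z :: v)

theorem Linked.trans (hx : HasOddCycles x) {a b c : α} (hb : x b ≠ b) (h : Linked x a b)
    (h' : Linked x b c) : Linked x a c := by
  intro u v hu hux hv hvx
  obtain ⟨w, hw, hwx⟩ := hx.exists_isSeparatedWord_cons hb
  exact (h u w hu hux hw hwx).trans (h' w v hw hwx hv hvx)

theorem length_tail (hk : numCycles x + 2 * (k + 1) = Fintype.card α) {t : Perm α}
    {u : List (Perm α)} (hu : IsSeparatedWord (t :: u)) (hx : (t :: u).prod = x) :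
    u.length = k := by
  have := hu.2
  rw [hx, List.length_cons] at this
  omega

theorem linked_of_eq (ih : HurwitzConnected α k)
    (hk : numCycles x + 2 * (k + 1) = Fintype.card α) {y z : α}
    (h : consecutiveCycle x y = consecutiveCycle x z) : Linked x y z := by
  intro u v hu hux hv hvx
  rw [← h] at hv hvx ⊢
  exact ih.cons (length_tail hk hu hux) hu hv (hux.trans hvx.symm)

theorem linked_of_fixed (ih : HurwitzConnected α k)
    (hk : numCycles x + 2 * (k + 1) = Fintype.card α) {y z : α} (hz : x z ≠ z)
    (h1 : consecutiveCycle x y (x z) = x z) (h2 : consecutiveCycle x y (x (x z)) = x (x z)) :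
    Linked x y z := by
  intro u v hu hux hv hvx
  obtain ⟨w, hw⟩ := ih.exists_consecutiveCycle_cons_of_fixed hu hux (length_tail hk hu hux) hz h1 h2
  have hwx := hw.prod_eq.symm.trans hux
  have hws := hu.of_hurwitzEquiv hw
  exact hw.trans (ih.cons (length_tail hk hws hwx) hws hv (hwx.trans hvx.symm))

theorem linked_apply_apply (ih : HurwitzConnected α k)
    (hk : numCycles x + 2 * (k + 1) = Fintype.card α) (hx : HasOddCycles x) {y : α}
    (hy : x y ≠ y) : Linked x y (x (x y)) := by
  have hsq := hx.sq_ne hy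
  have hy1 : x (x y) ≠ x y := fun h => hy (x.injective h)
  have hy2 : x (x (x y)) ≠ x (x y) := fun h => hy1 (x.injective h)
  have hy3 : x (x (x y)) ≠ x y := fun h => hsq (x.injective h)
  by_cases h3 : x (x (x y)) = y
  · apply ih.linked_of_eq hk
    have h0 := hx.consecutiveCycle_apply hy
    have h2 : consecutiveCycle x y (x (x y)) = y := HasOddCycles.consecutiveCycle_apply_sq
    have h := ((hx.isThreeCycle_consecutiveCycle hy).eq_swap_mul_swap_iff_mem_support
      (a := x (x y))).2 (mem_support.2 (by rw [h2]; exact hsq.symm))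
    rw [h2, h0] at h
    rw [h]
    conv_rhs => rw [consecutiveCycle, h3]
  -- The cycle now has at least five points, so its third and fourth iterates avoid `y`, `x y` and
  -- `x (x y)`.
  · have h4 : x (x (x (x y))) ≠ y := hx.pow_two_pow_apply_ne hy 2
    refine ih.linked_of_fixed hk hy2 ?_ ?_
    · exact HasOddCycles.consecutiveCycle_apply_of_ne h3 hy3 hy2
    · exact HasOddCycles.consecutiveCycle_apply_of_ne h4 (fun h => h3 (x.injective h))
        fun h => hy3 (x.injective h)

theorem linked (ih : HurwitzConnected α k) (hk : numCycles x + 2 * (k + 1) = Fintype.card α)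
    (hx : HasOddCycles x) {y z : α} (hy : x y ≠ y) (hz : x z ≠ z) : Linked x y z := by
  have heven : ∀ i : ℕ, x ((x ^ (2 * i)) y) ≠ (x ^ (2 * i)) y ∧ Linked x y ((x ^ (2 * i)) y) := by
    intro i
    induction i with
    | zero => exact ⟨hy, ih.linked_of_eq hk rfl⟩
    | succ i hi =>
      have h : (x ^ (2 * (i + 1))) y = x (x ((x ^ (2 * i)) y)) := by
        rw [mul_add, add_comm, pow_add]
        rfl
      rw [h]
      exact ⟨fun h => hi.1 (x.injective (x.injective h)),
        hi.2.trans hx hi.1 (ih.linked_apply_apply hk hx hi.1)⟩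
  by_cases hyz : x.SameCycle y z
  · obtain ⟨i, _, rfl⟩ := hyz.exists_pow_eq'
    rcases Nat.even_or_odd' i with ⟨j, rfl | rfl⟩
    · exact (heven j).2
    · obtain ⟨m, ⟨n, rfl⟩, hm⟩ := hx y
      -- Going once more around by an odd period of `y` turns the odd offset into an even one.
      have h := (heven (j + n + 1)).2
      have h2 : 2 * (j + n + 1) = (2 * j + 1) + (2 * n + 1) := by ring
      rwa [h2, pow_add, Perm.mul_apply, hm] at h
  -- In different cycles the two consecutive cycles are disjoint.
  · have of_eq : ∀ {a b}, a = b → x.SameCycle b a := fun h => h ▸ SameCycle.refl x _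
    refine ih.linked_of_fixed hk hz ?_ ?_ <;>
      refine HasOddCycles.consecutiveCycle_apply_of_ne (fun h => hyz ?_) (fun h => hyz ?_)
        (fun h => hyz ?_) <;>
      simpa using of_eq h

end HurwitzConnected

theorem hurwitzConnected (α : Type*) [Fintype α] [DecidableEq α] (k : ℕ) :
    HurwitzConnected α k := by
  induction k with
  | zero =>
    intro v v' hv h h' hp
    have h1 := h.2
    have h2 := h'.2
    rw [hp] at h1
    rw [List.eq_nil_of_length_eq_zero hv, List.eq_nil_of_length_eq_zero (l := v') (by omega)]
    exact HurwitzEquiv.refl _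
  | succ k ih =>
    intro w w' hw h h' hp
    have hk := h.2
    have hk' := h'.2
    rw [hw] at hk
    rw [← hp] at hk'
    match w, w' with
    | [], _ => simp at hw
    | _, [] => simp at hk'; omega
    | t :: u, t' :: u' =>
      rw [List.length_cons] at hw hk'
      obtain ⟨y, v, hy, hv⟩ := ih.exists_consecutiveCycle_cons h rfl (by omega)
      obtain ⟨z, v', hz, hv'⟩ := ih.exists_consecutiveCycle_cons h' hp.symm (by omega)
      have hl := ih.linked hk h.hasOddCycles hy hz v v' (h.of_hurwitzEquiv hv) hv.prod_eq.symm
        (h'.of_hurwitzEquiv hv') (hv'.prod_eq.symm.trans hp.symm)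
      exact (hv.trans hl).trans hv'.symm

end Transitivity

/-! ### Passage to the alternating group and the two implications. -/

theorem Multiset.odd_lcm {s : Multiset ℕ} (hs : ∀ n ∈ s, Odd n) : Odd s.lcm := by
  induction s using Multiset.induction_on with
  | empty => simp
  | cons n s ih =>
    rw [Multiset.lcm_cons]
    exact ((hs n (by simp)).mul (ih fun m hm => hs m (by simp [hm]))).of_dvd_nat
      (Nat.lcm_dvd_mul n s.lcm)

theorem hasOddCycles_of_mem_oddCyclePerms {N : ℕ} {x : alternatingGroup (Fin N)}
    (hx : x ∈ oddCyclePerms N) : HasOddCycles (x : Perm (Fin N)) := fun y =>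
  ⟨orderOf (x : Perm (Fin N)), lcm_cycleType (x : Perm (Fin N)) ▸ Multiset.odd_lcm hx, by
    rw [pow_orderOf_eq_one]; rfl⟩

theorem isThreeCycle_of_mem_map {N : ℕ} {w : List (alternatingGroup (Fin N))}
    (hw : ∀ t ∈ w, t ∈ threeCycles N) :
    ∀ t ∈ w.map (alternatingGroup (Fin N)).subtype, t.IsThreeCycle := by
  intro t ht
  obtain ⟨s, hs, rfl⟩ := List.mem_map.1 ht
  exact hw s hs

/-- The `3`-cycles and their inverses, again `3`-cycles, generate; so `wordLength` is a true
minimum, not the default `sInf ∅ = 0`. -/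
theorem reducedWords_threeCycles_nonempty {N : ℕ} (x : alternatingGroup (Fin N)) :
    (reducedWords (threeCycles N) x).Nonempty := by
  have hne : {k : ℕ | ∃ w : List (alternatingGroup (Fin N)), w.length = k ∧
      (∀ t ∈ w, t ∈ threeCycles N) ∧ w.prod = x}.Nonempty := by
    have hx : (x : Perm (Fin N)) ∈ Subgroup.closure {σ : Perm (Fin N) | σ.IsThreeCycle} := by
      rw [closure_three_cycles_eq_alternating]
      exact x.2
    rw [← Subgroup.mem_toSubmonoid, Subgroup.closure_toSubmonoid] at hx
    obtain ⟨l, hl, hprod⟩ := Submonoid.exists_list_of_mem_closure hx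
    have hl3 : ∀ t ∈ l, t.IsThreeCycle := fun t ht => (hl t ht).elim id IsThreeCycle.inv_iff.1
    lift l to List (alternatingGroup (Fin N)) using fun t ht => (hl3 t ht).mem_alternatingGroup
    refine ⟨l.length, l, rfl, fun t ht => hl3 t (List.mem_map_of_mem ht), ?_⟩
    apply Subtype.ext
    rw [← hprod]
    exact map_list_prod (alternatingGroup (Fin N)).subtype l
  obtain ⟨w, hlen, hw, hprod⟩ := Nat.sInf_mem hne
  exact ⟨⟨w, hlen⟩, hw, hprod⟩

theorem isSeparatedWord_of_mem_reducedWords {N : ℕ} {x : alternatingGroup (Fin N)}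
    (hx : HasOddCycles (x : Perm (Fin N)))
    {w : GroupWord (alternatingGroup (Fin N)) (wordLength (threeCycles N) x)}
    (hw : w ∈ reducedWords (threeCycles N) x) :
    IsSeparatedWord (w.1.map (alternatingGroup (Fin N)).subtype) ∧
      (w.1.map (alternatingGroup (Fin N)).subtype).prod = x := by
  have hprod : (w.1.map (alternatingGroup (Fin N)).subtype).prod = x := by
    rw [← map_list_prod, hw.2]
    rfl
  have h3 := isThreeCycle_of_mem_map hw.1
  refine ⟨⟨h3, le_antisymm ?_ (card_le_numCycles_prod_add _ h3)⟩, hprod⟩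
  obtain ⟨l, hl, hlx⟩ := hx.exists_isSeparatedWord
  have hl3 := hl.1
  lift l to List (alternatingGroup (Fin N)) using fun t ht => (hl3 t ht).mem_alternatingGroup
  have hle : wordLength (threeCycles N) x ≤ l.length := by
    refine Nat.sInf_le ⟨l, rfl, fun t ht => hl3 t (List.mem_map_of_mem ht), Subtype.ext ?_⟩
    rw [← hlx]
    exact map_list_prod (alternatingGroup (Fin N)).subtype l
  have h := hl.2
  rw [hlx, List.length_map] at h
  rw [hprod, List.length_map, w.2]
  omega

theorem isPretransitive_of_hasOddCycles {N : ℕ} {x : alternatingGroup (Fin N)}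
    (hx : HasOddCycles (x : Perm (Fin N))) :
    MulAction.IsPretransitive (BraidGroup (wordLength (threeCycles N) x))
      (reducedFactorizations (threeCycles N) (threeCycles_conj N) x) := by
  refine ⟨fun w w' => ?_⟩
  obtain ⟨h, hp⟩ := isSeparatedWord_of_mem_reducedWords hx w.2
  obtain ⟨h', hp'⟩ := isSeparatedWord_of_mem_reducedWords hx w'.2
  have hequiv := hurwitzConnected (Fin N) _ _ _ rfl h h' (hp.trans hp'.symm)
  obtain ⟨b, hb⟩ := (hequiv.of_map Subtype.val_injective).exists_smul_eq w.1.2 w'.1.2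
  exact ⟨b, Subtype.ext hb⟩

theorem spinProd_smul {N : ℕ} {R : Type*} [Ring R] {e : Fin N → R} (he : IsCliffordFamily e)
    {x : alternatingGroup (Fin N)} (b : BraidGroup (wordLength (threeCycles N) x))
    {w : GroupWord (alternatingGroup (Fin N)) (wordLength (threeCycles N) x)}
    (hw : w ∈ reducedWords (threeCycles N) x) :
    spinProd e ((b • w).1.map (alternatingGroup (Fin N)).subtype) =
      spinProd e (w.1.map (alternatingGroup (Fin N)).subtype) := by
  have hgen : ∀ i, ∀ w ∈ reducedWords (threeCycles N) x,
      spinProd e (((PresentedGroup.of i : BraidGroup (wordLength (threeCycles N) x)) • w).1.map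
        (alternatingGroup (Fin N)).subtype) =
      spinProd e (w.1.map (alternatingGroup (Fin N)).subtype) := by
    intro i w hw
    have hmap : (hurwitzMove (i : ℕ) w.1).map (alternatingGroup (Fin N)).subtype =
        hurwitzMove (i : ℕ) (w.1.map (alternatingGroup (Fin N)).subtype) := by
      generalize w.1 = l
      generalize (i : ℕ) = j
      fun_induction hurwitzMove j l <;> simp_all [hurwitzMove]
    rw [hurwitz_of_smul, hmap, he.spinProd_hurwitzMove _ _ (isThreeCycle_of_mem_map hw.1)]
  have hmem := fun (b : BraidGroup (wordLength (threeCycles N) x)) w hw =>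
    hurwitz_smul_mem_reducedWords (threeCycles_conj N) x b (w := w) hw
  have hb : b ∈ Subgroup.closure (Set.range (PresentedGroup.of (rels := braidRels
      (wordLength (threeCycles N) x)))) := by
    rw [PresentedGroup.closure_range_of]
    trivial
  induction hb using Subgroup.closure_induction generalizing w with
  | mem b hb =>
    obtain ⟨i, rfl⟩ := hb
    exact hgen i w hw
  | one => rw [one_smul]
  | mul b c _ _ hb hc => rw [mul_smul, hb (hmem c w hw), hc hw]
  | inv b _ hb => rw [← hb (hmem b⁻¹ w hw), smul_inv_smul]

theorem not_isPretransitive {N : ℕ} {x : alternatingGroup (Fin N)} (hx : x ∉ oddCyclePerms N) :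
    ¬MulAction.IsPretransitive (BraidGroup (wordLength (threeCycles N) x))
      (reducedFactorizations (threeCycles N) (threeCycles_conj N) x) := by
  intro htrans
  obtain ⟨c, hc, heven⟩ : ∃ c ∈ (x : Perm (Fin N)).cycleFactorsFinset, Even c.support.card := by
    simp only [oddCyclePerms, Set.mem_ofPred_eq, cycleType_def, Multiset.mem_map] at hx
    push Not at hx
    obtain ⟨n, ⟨c, hc, rfl⟩, hn⟩ := hx
    exact ⟨c, hc, Nat.not_odd_iff_even.1 hn⟩
  obtain ⟨hcyc, hcx⟩ := mem_cycleFactorsFinset_iff.1 hc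
  have hsign : sign c = -1 := by rw [hcyc.sign, heven.neg_one_pow]
  have hcomm : c * (x : Perm (Fin N)) * c⁻¹ = x := by
    rw [mul_inv_eq_iff_eq_mul]
    exact self_mem_cycle_factors_commute hc
  obtain ⟨w, hw⟩ := reducedWords_threeCycles_nonempty x
  -- `c` is odd, hence outside the alternating group, but normality lets it act there by
  -- conjugation.
  let conj : MulAut (alternatingGroup (Fin N)) := MulAut.conjNormal c
  have hw' : (⟨w.1.map conj, (List.length_map _).trans w.2⟩ :
      GroupWord (alternatingGroup (Fin N)) _) ∈ reducedWords (threeCycles N) x := by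
    refine ⟨?_, ?_⟩
    · intro t ht
      obtain ⟨s, hs, rfl⟩ := List.mem_map.1 ht
      have hs3 := hw.1 s hs
      simpa [threeCycles, IsThreeCycle, conj, MulAut.conjNormal_apply, cycleType_conj] using hs3
    · rw [← map_list_prod, hw.2]
      apply Subtype.ext
      rw [MulAut.conjNormal_apply, hcomm]
  obtain ⟨b, hb⟩ := htrans.exists_smul_eq ⟨w, hw⟩ ⟨_, hw'⟩
  obtain ⟨R, _, _, _, e, he⟩ := exists_isCliffordFamily (Fin N)
  have h1 := spinProd_smul he b hw
  have hbw : b • w = ⟨w.1.map conj, (List.length_map _).trans w.2⟩ := congrArg Subtype.val hb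
  have hprod : (w.1.map (alternatingGroup (Fin N)).subtype).prod = x := by
    rw [← map_list_prod, hw.2]
    rfl
  have h3 := isThreeCycle_of_mem_map hw.1
  have hmap : (w.1.map conj).map (alternatingGroup (Fin N)).subtype =
      (w.1.map (alternatingGroup (Fin N)).subtype).map fun t => c * t * c⁻¹ := by
    rw [List.map_map, List.map_map]
    rfl
  rw [hbw] at h1
  change spinProd e ((w.1.map conj).map _) = _ at h1
  rw [hmap, he.spinProd_conj hsign hcx _ h3 hprod] at h1
  have h2 : (2 : ℚ) • spinProd e (w.1.map (alternatingGroup (Fin N)).subtype) = 0 := by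
    rw [two_smul]
    nth_rewrite 1 [← h1]
    exact neg_add_cancel _
  exact (he.isUnit_spinProd _ h3).ne_zero ((smul_eq_zero.1 h2).resolve_left two_ne_zero)

theorem mainTheorem3 (N : ℕ) (hN : 3 ≤ N) (x : alternatingGroup (Fin N)) :
    x ∈ oddCyclePerms N ↔
      MulAction.IsPretransitive (BraidGroup (wordLength (threeCycles N) x))
        (reducedFactorizations (threeCycles N) (threeCycles_conj N) x) :=
  ⟨fun hx => isPretransitive_of_hasOddCycles (hasOddCycles_of_mem_oddCyclePerms hx),
    fun h => not_not.1 fun hx => not_isPretransitive hx h⟩
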